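/- Let $G$ be a finite simple planar graph with $n \ge 4$ vertices. Call two distinct cycles of $G$ adjacent if they have a common edge. If no triangle (cycle of length $3$) of $G$ is adjacent to a cycle of length $3$ or $5$, then $$|E(G)| \le 2(n-2).$$ -/

import Mathlib

/-- A drawing of the graph `G` in the Euclidean plane without crossings: the vertices are distinct
points, every edge is a simple (Jordan) arc joining its two ends, and the interior of an edge
contains no vertex and no point of any other edge. -/
structure SimpleGraph.PlaneDrawing {V : Type*} (G : SimpleGraph V) where
  /-- the point that represents a vertex -/
  point : V → EuclideanSpace ℝ (Fin 2)
  /-- a parametrization of the arc that represents an edge -/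
  arc : G.edgeSet → unitInterval → EuclideanSpace ℝ (Fin 2)
  point_injective : Function.Injective point
  arc_continuous : ∀ e, Continuous (arc e)
  arc_injective : ∀ e, Function.Injective (arc e)
  arc_ends : ∀ e, s(arc e 0, arc e 1) = Sym2.map point (e : Sym2 V)
  arc_ne_point : ∀ e, ∀ t ∈ Set.Ioo (0 : unitInterval) 1, ∀ v, arc e t ≠ point v
  arc_ne_arc : ∀ e f, e ≠ f → ∀ s ∈ Set.Ioo (0 : unitInterval) 1,
    ∀ t ∈ Set.Ioo (0 : unitInterval) 1, arc e s ≠ arc f t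

/-- A graph is planar if it can be drawn in the plane without crossings. -/
def SimpleGraph.IsPlanar {V : Type*} (G : SimpleGraph V) : Prop :=
  Nonempty G.PlaneDrawing

/-- Two cycles, given by closed walks, are adjacent if they are different cycles (as subgraphs, so
that the starting vertex and the direction of the walks do not matter) and have a common edge. -/
def SimpleGraph.AdjacentCycles {V : Type*} {G : SimpleGraph V} {u v : V}
    (c : G.Walk u u) (d : G.Walk v v) : Prop :=
  c.IsCycle ∧ d.IsCycle ∧ c.toSubgraph ≠ d.toSubgraph ∧ ∃ e, e ∈ c.edges ∧ e ∈ d.edges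

/-- Some triangle of `G` is adjacent to some cycle of length `k` of `G`. -/
def SimpleGraph.HasTriangleAdjacentToCycle {V : Type*} (G : SimpleGraph V) (k : ℕ) : Prop :=
  ∃ (u v : V) (c : G.Walk u u) (d : G.Walk v v),
    c.length = 3 ∧ d.length = k ∧ SimpleGraph.AdjacentCycles c d

/-! The bound combines Euler's inequality |E| + 2 ≤ |F| + n with 2|F| ≤ |E|. For the latter, each
edge hands at most 6 units to its two faces: 4 + 2 if one of them is a triangle, 3 + 3 otherwise. A
face boundary is an even edge set, hence a cycle if it has at most five edges. A face that shares an
edge with a triangle has at least six edges: lengths 3 and 5 are excluded, and a quadrilateral would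
create a forbidden 3- or 5-cycle. So every face receives at least 12
(`two_mul_card_le_of_discharging`, `IsEvenEdgeSet.six_le_card`).

Faces are produced algebraically. For an arc with ends a, b there is a branch of √((z - a)(z - b))
off the arc. Its sign against chosen roots of z - a and z - b, taken over all arcs, is a vector in
(ℤ/2)^E. Other choices of the roots change it by a cut, so each point z has a class in the edge
space modulo the cut space. This class is locally constant off the drawing, and across an edge it
moves at most by the class of that edge.

Given a ℤ/2-valued function φ of classes, multiply the branches of the edges across which φ jumps by
the sign of φ. The jumps cancel, and the product extends continuously to all points but the vertices
(`exists_continuousOn_signedBranch`). Monodromy around a vertex shows that the jump edges have even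
degree there (`even_card_support`). If φ has no jumps, connectedness makes it constant on the
classes of points off the drawing (`apply_face_eq`). The quotient has dimension at least |E| - n + 1
and is spanned by differences of faces, whence Euler's inequality (`exists_faces`). -/

open Topology

/-! ### Continuous square roots in the plane -/

/-- A continuous branch of `√((z - γ 0) (z - γ 1))` off a curve `γ`. -/
theorem exists_sqrt_compl_range (γ : unitInterval → ℂ) (hγ : Continuous γ) :
    ∃ σ : ℂ → ℂ, ContinuousOn σ (Set.range γ)ᶜ ∧
      ∀ z, z ∉ Set.range γ → σ z ^ 2 = (z - γ 0) * (z - γ 1) := by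
  have hne : ∀ (t : unitInterval) (z : ((Set.range γ)ᶜ : Set ℂ)), (z : ℂ) - γ t ≠ 0 :=
    fun t z h => z.2 ⟨t, (sub_eq_zero.1 h).symm⟩
  -- The quotient moves from the constant 1 at t = 0 to (z - γ 1) / (z - γ 0) at t = 1. Lifting this
  -- homotopy through `exp` gives a continuous logarithm of the endpoint, which can be halved.
  let H : C(unitInterval × ((Set.range γ)ᶜ : Set ℂ), {z : ℂ // z ≠ 0}) :=
    ⟨fun x => ⟨((x.2 : ℂ) - γ x.1) / ((x.2 : ℂ) - γ 0),
      div_ne_zero (hne _ _) (hne _ _)⟩, by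
        refine Continuous.subtype_mk (Continuous.div ?_ ?_ fun x => hne _ _) _ <;> fun_prop⟩
  let f : C(((Set.range γ)ᶜ : Set ℂ), ℂ) := ⟨fun _ => 0, continuous_const⟩
  have H0 : ∀ z, H (0, z) = ⟨_, (f z).exp_ne_zero⟩ := fun z => by
    apply Subtype.ext
    simp [H, f, div_self (hne 0 z)]
  let L := Complex.isCoveringMap_exp.liftHomotopy H f H0
  have hL : ∀ z, Complex.exp (L (1, z)) = ((z : ℂ) - γ 1) / ((z : ℂ) - γ 0) := fun z =>
    congrArg Subtype.val (congrFun (Complex.isCoveringMap_exp.liftHomotopy_lifts H f H0) (1, z))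
  classical
  refine ⟨fun z => if hz : z ∈ (Set.range γ)ᶜ then
    Complex.exp (L (1, ⟨z, hz⟩) / 2) * (z - γ 0) else 0, ?_, fun z hz => ?_⟩
  · rw [continuousOn_iff_continuous_domRestrict]
    have : Continuous fun z : ((Set.range γ)ᶜ : Set ℂ) =>
        Complex.exp (L (1, z) / 2) * ((z : ℂ) - γ 0) := by fun_prop
    refine this.congr fun z => ?_
    have hz : (z : ℂ) ∈ (Set.range γ)ᶜ := z.2
    simp only [Set.domRestrict_apply, dif_pos hz]
  · have hz' : z ∈ (Set.range γ)ᶜ := hz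
    have h0 := hne 0 ⟨z, hz'⟩
    simp only [dif_pos hz', mul_pow, ← Complex.exp_nat_mul]
    rw [show ((2 : ℕ) : ℂ) * (L (1, ⟨z, hz'⟩) / 2) = L (1, ⟨z, hz'⟩) by push_cast; ring, hL]
    simp only at h0 ⊢
    field_simp

/-- On the disc, (z - v) / (z₀ - v) stays within distance 1 of 1, where the principal root is
continuous. If v = z₀, the disc is empty. -/
theorem exists_sqrt_ball (v z₀ : ℂ) (r : ℝ) (hr : r ≤ dist v z₀) :
    ∃ ρ : ℂ → ℂ, ContinuousOn ρ (Metric.ball z₀ r) ∧ ∀ z, ρ z ^ 2 = z - v := by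
  obtain rfl | hv := eq_or_ne v z₀
  · rw [dist_self] at hr
    refine ⟨fun z => (z - v) ^ (1 / 2 : ℂ), by simp [Metric.ball_eq_empty.2 hr], fun z => ?_⟩
    rw [← Complex.cpow_nat_mul]; norm_num
  · have h0 : z₀ - v ≠ 0 := sub_ne_zero.2 hv.symm
    refine ⟨fun z => (z₀ - v) ^ (1 / 2 : ℂ) * ((z - v) / (z₀ - v)) ^ (1 / 2 : ℂ), ?_, fun z => ?_⟩
    · refine continuousOn_const.mul (ContinuousOn.cpow_const (by fun_prop) fun z hz => ?_)
      rw [show (z - v) / (z₀ - v) = 1 + (z - z₀) / (z₀ - v) by field_simp; ring]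
      apply Complex.mem_slitPlane_of_norm_lt_one
      rw [norm_div, div_lt_one (norm_pos_iff.2 h0), ← dist_eq_norm, ← dist_eq_norm, dist_comm z₀]
      exact (Metric.mem_ball.1 hz).trans_le hr
    · rw [mul_pow, ← Complex.cpow_nat_mul, ← Complex.cpow_nat_mul]
      norm_num
      field_simp

theorem isPreconnected_punctured_ball (c : ℂ) (r : ℝ) :
    IsPreconnected (Metric.ball c r \ {c}) := by
  have : Metric.ball c r \ {c} =
      (fun x : ℝ × ℝ => c + x.1 * Complex.exp (x.2 * Complex.I)) '' (Set.Ioo 0 r ×ˢ Set.univ) := by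
    ext z
    constructor
    · rintro ⟨hz, hzc⟩
      refine ⟨(‖z - c‖, Complex.arg (z - c)), ⟨⟨norm_pos_iff.2 (sub_ne_zero.2 hzc), ?_⟩, trivial⟩, ?_⟩
      · simpa [dist_eq_norm] using hz
      · simp [Complex.norm_mul_exp_arg_mul_I]
    · rintro ⟨⟨ρ, θ⟩, ⟨⟨h0, h1⟩, -⟩, rfl⟩
      simp only at h0 h1
      refine ⟨?_, ?_⟩
      · simp [dist_eq_norm, Complex.norm_exp_ofReal_mul_I, abs_of_pos h0, h1]
      · simp [h0.ne']
  rw [this]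
  refine (isPreconnected_Ioo.prod isPreconnected_univ).image _ (Continuous.continuousOn ?_)
  fun_prop

/-- There is no continuous branch of `√(z - v)` on a punctured disc. -/
theorem not_exists_sqrt_punctured_ball (v : ℂ) (r : ℝ) (hr : 0 < r) (s : ℂ → ℂ)
    (hs : ContinuousOn s (Metric.ball v r \ {v}))
    (h : ∀ z ∈ Metric.ball v r \ {v}, s z ^ 2 = z - v) : False := by
  let c : ℝ → ℂ := fun θ => v + (r / 2 : ℝ) * Complex.exp (θ * Complex.I)
  have hc : ∀ θ, c θ ∈ Metric.ball v r \ {v} := fun θ => by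
    refine ⟨?_, ?_⟩
    · simp [c, dist_eq_norm, Complex.norm_exp_ofReal_mul_I, abs_of_pos hr, hr]
    · simp [c, hr.ne']
  have hcc : Continuous c := by fun_prop
  -- With half the angle removed, q² is constant, so q is constant on the line; yet a full turn
  -- changes its sign.
  let q : ℝ → ℂ := fun θ => s (c θ) * Complex.exp (-(θ / 2 * Complex.I))
  have hq : Continuous q := (hs.comp_continuous hcc hc).mul (by fun_prop)
  have hq2 : ∀ θ, q θ ^ 2 = (r / 2 : ℝ) := fun θ => by
    simp only [q, mul_pow, h _ (hc θ), ← Complex.exp_nat_mul, c, add_sub_cancel_left]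
    rw [mul_assoc, ← Complex.exp_add]
    ring_nf
    simp
  have hr' : ((r / 2 : ℝ) : ℂ) ≠ 0 := by exact_mod_cast (half_pos hr).ne'
  have hq0 : ∀ θ, q θ ≠ 0 := fun θ h0 => hr' (by rw [← hq2 θ, h0]; simp)
  have hEq : Set.EqOn q (fun _ => q 0) Set.univ := by
    refine isPreconnected_univ.eq_of_sq_eq hq.continuousOn continuousOn_const
      (fun x _ => by simp [hq2]) (fun _ => hq0 0) (Set.mem_univ 0) rfl
  have h2 := hEq (Set.mem_univ (2 * Real.pi))
  have hcp : c (2 * Real.pi) = c 0 := by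
    simp [c, Complex.exp_two_pi_mul_I]
  have e1 : q (2 * Real.pi) = - q 0 := by
    have : Complex.exp (-(((2 * Real.pi : ℝ) : ℂ) / 2 * Complex.I)) = -1 := by
      rw [Complex.exp_neg]
      push_cast
      rw [mul_div_cancel_left₀ _ (two_ne_zero), Complex.exp_pi_mul_I]; norm_num
    simp only [q, hcp, this]
    simp
  simp only [e1] at h2
  exact hq0 0 (self_eq_neg.1 h2.symm)

/-! ### Simple arcs have dense complement -/

/-- A simple arc has empty interior. -/
theorem interior_range_eq_empty (γ : unitInterval → ℂ) (hγ : Continuous γ)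
    (hi : Function.Injective γ) : interior (Set.range γ) = ∅ := by
  by_contra hne
  obtain ⟨z, hz⟩ := Set.nonempty_iff_ne_empty.2 hne
  have hemb : IsClosedEmbedding γ := hγ.isClosedEmbedding hi
  obtain ⟨t₀, ht₀⟩ := interior_subset hz
  have hopen : IsOpen (γ ⁻¹' interior (Set.range γ)) := isOpen_interior.preimage hγ
  have hd : Dense (Set.Ioo (0 : unitInterval) 1) := by
    rw [dense_iff_closure_eq, closure_Ioo (by simp), ← unitInterval.univ_eq_Icc]
  obtain ⟨t, ht, ht1⟩ := hd.exists_mem_open hopen ⟨t₀, by simpa [ht₀] using hz⟩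
  obtain ⟨r, hr, hball⟩ := Metric.isOpen_iff.1 isOpen_interior _ ht1
  have hsub : Metric.ball (γ t) r ⊆ Set.range γ := hball.trans interior_subset
  -- The preimage of the punctured disc is connected, hence order-convex in the interval; but it has
  -- points on both sides of t and omits t.
  have hpre : IsPreconnected (γ ⁻¹' (Metric.ball (γ t) r \ {γ t})) :=
    (isPreconnected_punctured_ball _ _).preimage_of_isClosedMap hi hemb.isClosedMap
      (Set.sdiff_subset.trans hsub)
  have hn : γ ⁻¹' Metric.ball (γ t) r ∈ 𝓝 t :=
    (Metric.isOpen_ball.preimage hγ).mem_nhds (by simpa using hr)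
  obtain ⟨l, hl, hl'⟩ := exists_Ioc_subset_of_mem_nhds hn ⟨0, ht.1⟩
  obtain ⟨u, hu, hu'⟩ := exists_Ico_subset_of_mem_nhds hn ⟨1, ht.2⟩
  obtain ⟨a, ha1, ha2⟩ := exists_between hl
  obtain ⟨b, hb1, hb2⟩ := exists_between hu
  have h := hpre.ordConnected.out (x := a) (y := b)
    ⟨hl' ⟨ha1, ha2.le⟩, fun h => ha2.ne (hi h)⟩ ⟨hu' ⟨hb1.le, hb2⟩, fun h => hb1.ne' (hi h)⟩
    ⟨ha2.le, hb1.le⟩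
  exact h.2 rfl

theorem dense_compl_iUnion_range {E : Type*} [Finite E] (γ : E → unitInterval → ℂ)
    (hγ : ∀ e, Continuous (γ e)) (hi : ∀ e, Function.Injective (γ e)) :
    Dense (⋃ e, Set.range (γ e))ᶜ := by
  rw [Set.compl_iUnion]
  refine dense_iInter_of_isOpen (fun e => (isCompact_range (hγ e)).isClosed.isOpen_compl) fun e => ?_
  rw [← interior_eq_empty_iff_dense_compl]
  exact interior_range_eq_empty _ (hγ e) (hi e)

/-! ### Arc systems and signs modulo 2 -/

/-- Finitely many simple arcs in the plane that meet at most at their ends. -/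
structure ArcSystem (V E : Type*) where
  /-- the vertices -/
  pt : V → ℂ
  /-- the arcs -/
  arc : E → unitInterval → ℂ
  /-- the first end of an arc -/
  src : E → V
  /-- the second end of an arc -/
  tgt : E → V
  pt_injective : Function.Injective pt
  arc_continuous : ∀ e, Continuous (arc e)
  arc_injective : ∀ e, Function.Injective (arc e)
  arc_zero : ∀ e, arc e 0 = pt (src e)
  arc_one : ∀ e, arc e 1 = pt (tgt e)
  arc_ne_pt : ∀ e, ∀ t ∈ Set.Ioo (0 : unitInterval) 1, ∀ v, arc e t ≠ pt v
  arc_ne_arc : ∀ e f, e ≠ f → ∀ s ∈ Set.Ioo (0 : unitInterval) 1,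
    ∀ t ∈ Set.Ioo (0 : unitInterval) 1, arc e s ≠ arc f t

/-- The sign attached to a residue modulo `2`. -/
noncomputable def zmodTwoSign (x : ZMod 2) : ℂ := if x = 0 then 1 else -1

theorem zmodTwoSign_add (x y : ZMod 2) :
    zmodTwoSign (x + y) = zmodTwoSign x * zmodTwoSign y := by
  have h : ∀ x : ZMod 2, x = 0 ∨ x = 1 := by decide
  rcases h x with rfl | rfl <;> rcases h y with rfl | rfl <;>
    simp [zmodTwoSign, show (1 + 1 : ZMod 2) = 0 by decide]

theorem zmodTwoSign_sum {ι : Type*} (s : Finset ι) (x : ι → ZMod 2) :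
    zmodTwoSign (∑ i ∈ s, x i) = ∏ i ∈ s, zmodTwoSign (x i) := by
  classical
  induction s using Finset.induction_on with
  | empty => simp [zmodTwoSign]
  | insert a s ha ih => rw [Finset.sum_insert ha, Finset.prod_insert ha, zmodTwoSign_add, ih]

theorem zmodTwoSign_sq (x : ZMod 2) : zmodTwoSign x ^ 2 = 1 := by
  unfold zmodTwoSign; split_ifs <;> norm_num

theorem zmodTwoSign_ne_zero (x : ZMod 2) : zmodTwoSign x ≠ 0 := by
  unfold zmodTwoSign; split_ifs <;> norm_num

theorem zmodTwoSign_injective : Function.Injective zmodTwoSign := by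
  have h : ∀ x : ZMod 2, x = 0 ∨ x = 1 := by decide
  intro x y hxy
  rcases h x with rfl | rfl <;> rcases h y with rfl | rfl <;>
    simp [zmodTwoSign] at hxy ⊢ <;> norm_num [self_eq_neg, eq_neg_iff_add_eq_zero] at hxy

theorem exists_zmodTwoSign_mul {u v : ℂ} (h : u ^ 2 = v ^ 2) : ∃ x, u = zmodTwoSign x * v := by
  rcases sq_eq_sq_iff_eq_or_eq_neg.1 h with h | h
  · exact ⟨0, by simp [zmodTwoSign, h]⟩
  · exact ⟨1, by simp [zmodTwoSign, h]⟩

namespace ArcSystem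

variable {V E : Type*} (D : ArcSystem V E)

theorem src_ne_tgt (e : E) : D.src e ≠ D.tgt e := fun h => by
  have := D.arc_injective e ((D.arc_zero e).trans ((congrArg D.pt h).trans (D.arc_one e).symm))
  exact zero_ne_one this

theorem mem_Ioo_of_notMem_range {e : E} {t : unitInterval} (h : D.arc e t ∉ Set.range D.pt) :
    t ∈ Set.Ioo (0 : unitInterval) 1 := by
  refine ⟨unitInterval.pos_iff_ne_zero.2 ?_, unitInterval.lt_one_iff_ne_one.2 ?_⟩
  · rintro rfl; exact h ⟨_, (D.arc_zero e).symm⟩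
  · rintro rfl; exact h ⟨_, (D.arc_one e).symm⟩

theorem eq_of_mem_range {e f : E} {z : ℂ} (hz : z ∉ Set.range D.pt)
    (he : z ∈ Set.range (D.arc e)) (hf : z ∈ Set.range (D.arc f)) : e = f := by
  obtain ⟨s, rfl⟩ := he
  obtain ⟨t, ht⟩ := hf
  by_contra hne
  refine D.arc_ne_arc e f hne s (D.mem_Ioo_of_notMem_range hz) t
    (D.mem_Ioo_of_notMem_range (ht ▸ hz)) ht.symm

/-! ### Classes of points in the edge space modulo the cut space -/

/-- The complement of the drawing. -/
def outside : Set ℂ := (⋃ e, Set.range (D.arc e))ᶜ \ Set.range D.pt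

/-- A branch of `√((z - src) (z - tgt))` off the arc. -/
noncomputable def branch (e : E) : ℂ → ℂ :=
  (exists_sqrt_compl_range (D.arc e) (D.arc_continuous e)).choose

theorem continuousOn_branch (e : E) : ContinuousOn (D.branch e) (Set.range (D.arc e))ᶜ :=
  (exists_sqrt_compl_range (D.arc e) (D.arc_continuous e)).choose_spec.1

theorem branch_sq (e : E) {z : ℂ} (hz : z ∉ Set.range (D.arc e)) :
    D.branch e z ^ 2 = (z - D.pt (D.src e)) * (z - D.pt (D.tgt e)) := by
  rw [← D.arc_zero, ← D.arc_one]
  exact (exists_sqrt_compl_range (D.arc e) (D.arc_continuous e)).choose_spec.2 z hz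

open Classical in
/-- The sign of `branch` relative to the product of the principal square roots at the ends. -/
noncomputable def theta (z : ℂ) (e : E) : ZMod 2 :=
  if D.branch e z = (z - D.pt (D.src e)) ^ (1 / 2 : ℂ) * (z - D.pt (D.tgt e)) ^ (1 / 2 : ℂ)
  then 0 else 1

theorem branch_eq_theta (e : E) {z : ℂ} (hz : z ∉ Set.range (D.arc e)) :
    D.branch e z = zmodTwoSign (D.theta z e) *
      ((z - D.pt (D.src e)) ^ (1 / 2 : ℂ) * (z - D.pt (D.tgt e)) ^ (1 / 2 : ℂ)) := by
  have h : D.branch e z ^ 2 =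
      ((z - D.pt (D.src e)) ^ (1 / 2 : ℂ) * (z - D.pt (D.tgt e)) ^ (1 / 2 : ℂ)) ^ 2 := by
    rw [D.branch_sq e hz, mul_pow, ← Complex.cpow_nat_mul, ← Complex.cpow_nat_mul]
    norm_num
  unfold theta
  split_ifs with h1
  · simp [zmodTwoSign, h1]
  · rcases sq_eq_sq_iff_eq_or_eq_neg.1 h with h2 | h2
    · exact absurd h2 h1
    · simp [zmodTwoSign, h2]

/-- The coboundary map modulo `2`. -/
def coboundary : (V → ZMod 2) →ₗ[ZMod 2] (E → ZMod 2) where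
  toFun x e := x (D.src e) + x (D.tgt e)
  map_add' x y := by ext e; simp only [Pi.add_apply]; ring
  map_smul' c x := by ext e; simp [mul_add]

/-- Two choices of √(z - v) differ by a sign at each vertex, and these signs enter the edge
coordinates as a coboundary. Thus the principal roots in `theta`, discontinuous as they are, may be
replaced by locally continuous ones. -/
theorem exists_theta_eq {z : ℂ} (hz : z ∉ Set.range D.pt) (ρ : V → ℂ)
    (hρ : ∀ v, ρ v ^ 2 = z - D.pt v) : ∃ x : V → ZMod 2, ∀ e (y : ZMod 2),
      z ∉ Set.range (D.arc e) →
      D.branch e z = zmodTwoSign y * (ρ (D.src e) * ρ (D.tgt e)) →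
      D.theta z e = y + D.coboundary x e := by
  have h : ∀ v, ∃ x, (z - D.pt v) ^ (1 / 2 : ℂ) = zmodTwoSign x * ρ v := fun v => by
    apply exists_zmodTwoSign_mul
    rw [hρ, ← Complex.cpow_nat_mul]; norm_num
  choose x hx using h
  have hρ0 : ∀ v, ρ v ≠ 0 := fun v h0 => hz ⟨v, by
    have := hρ v
    rw [h0] at this
    exact (sub_eq_zero.1 (by simpa using this.symm)).symm⟩
  refine ⟨x, fun e y he hy => ?_⟩
  rw [D.branch_eq_theta e he, hx, hx] at hy
  have : zmodTwoSign (D.theta z e + D.coboundary x e) = zmodTwoSign y := by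
    apply mul_right_cancel₀ (mul_ne_zero (hρ0 (D.src e)) (hρ0 (D.tgt e)))
    rw [← hy, zmodTwoSign_add]
    simp only [coboundary, LinearMap.coe_mk, AddHom.coe_mk, zmodTwoSign_add]
    ring
  rw [← zmodTwoSign_injective this, add_assoc, CharTwo.add_self_eq_zero, add_zero]

/-- The edge space modulo the cut space; its elements serve as faces. -/
abbrev FaceSpace : Type _ := (E → ZMod 2) ⧸ LinearMap.range D.coboundary

/-- The class of a point of the plane in the face space. -/
noncomputable def face (z : ℂ) : D.FaceSpace := Submodule.Quotient.mk (D.theta z)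

open Classical in
/-- The class of an edge in the face space. -/
noncomputable def dual (e : E) : D.FaceSpace := Submodule.Quotient.mk (Pi.single e 1)

theorem mk_coboundary (x : V → ZMod 2) :
    (Submodule.Quotient.mk (D.coboundary x) : D.FaceSpace) = 0 :=
  (Submodule.Quotient.mk_eq_zero _).2 ⟨x, rfl⟩

theorem face_eq_mk {z : ℂ} (hz : z ∈ D.outside) (ρ : V → ℂ)
    (hρ : ∀ v, ρ v ^ 2 = z - D.pt v) (η : E → ZMod 2)
    (hη : ∀ e, D.branch e z = zmodTwoSign (η e) * (ρ (D.src e) * ρ (D.tgt e))) :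
    D.face z = Submodule.Quotient.mk η := by
  obtain ⟨x, hx⟩ := D.exists_theta_eq hz.2 ρ hρ
  have : D.theta z = η + D.coboundary x := funext fun e =>
    hx e (η e) (fun h => hz.1 (Set.mem_iUnion.2 ⟨e, h⟩)) (hη e)
  rw [face, this, Submodule.Quotient.mk_add, mk_coboundary, add_zero]

theorem notMem_range_arc_of_ne {e f : E} (hf : f ≠ e) {t : unitInterval}
    (ht : t ∈ Set.Ioo (0 : unitInterval) 1) : D.arc e t ∉ Set.range (D.arc f) := fun h => by
  have : D.arc e t ∉ Set.range D.pt := fun ⟨v, hv⟩ => D.arc_ne_pt e t ht v hv.symm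
  exact hf (D.eq_of_mem_range this h ⟨t, rfl⟩)

section Local

variable [Finite V] [Finite E]

/-- Near a point that is not a vertex all vertex roots can be chosen continuous. On a connected disc
that misses the arc, the branch and the product of roots have equal squares, so their ratio is a
constant sign. -/
theorem exists_local_branch {z₀ : ℂ} (hz₀ : z₀ ∉ Set.range D.pt) :
    ∃ r > 0, ∃ (ρ : V → ℂ → ℂ) (c : E → ZMod 2),
      (∀ v, ContinuousOn (ρ v) (Metric.ball z₀ r)) ∧ (∀ v z, ρ v z ^ 2 = z - D.pt v) ∧
      (∀ z ∈ Metric.ball z₀ r, z ∉ Set.range D.pt) ∧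
      ∀ e, z₀ ∉ Set.range (D.arc e) → ∀ z ∈ Metric.ball z₀ r, z ∉ Set.range (D.arc e) ∧
        D.branch e z = zmodTwoSign (c e) * (ρ (D.src e) z * ρ (D.tgt e) z) := by
  have h1 : ∀ᶠ z in 𝓝 z₀, z ∉ Set.range D.pt :=
    (Set.finite_range D.pt).isClosed.isOpen_compl.mem_nhds hz₀
  have h2 : ∀ᶠ z in 𝓝 z₀, ∀ e, z₀ ∉ Set.range (D.arc e) → z ∉ Set.range (D.arc e) := by
    rw [Filter.eventually_all]
    intro e
    by_cases he : z₀ ∈ Set.range (D.arc e)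
    · simp [he]
    · filter_upwards [(isCompact_range (D.arc_continuous e)).isClosed.isOpen_compl.mem_nhds he]
        with z hz _ using hz
  obtain ⟨r, hr, hball⟩ := Metric.eventually_nhds_iff_ball.1 (h1.and h2)
  have h3 : ∀ v, r ≤ dist (D.pt v) z₀ := fun v => by
    by_contra! h
    exact (hball _ h).1 ⟨v, rfl⟩
  choose ρ hρc hρ using fun v => exists_sqrt_ball (D.pt v) z₀ r (h3 v)
  have hρ0 : ∀ v, ∀ z ∈ Metric.ball z₀ r, ρ v z ≠ 0 := fun v z hz h0 => (hball z hz).1 ⟨v, by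
    have := hρ v z
    rw [h0] at this
    exact (sub_eq_zero.1 (by simpa using this.symm)).symm⟩
  have hz₀r : z₀ ∈ Metric.ball z₀ r := Metric.mem_ball_self hr
  have h4 : ∀ e, ∃ c, z₀ ∉ Set.range (D.arc e) → ∀ z ∈ Metric.ball z₀ r,
      D.branch e z = zmodTwoSign c * (ρ (D.src e) z * ρ (D.tgt e) z) := fun e => by
    by_cases he : z₀ ∈ Set.range (D.arc e)
    · exact ⟨0, fun h => absurd he h⟩
    have hsq : ∀ z ∈ Metric.ball z₀ r,
        D.branch e z ^ 2 = (ρ (D.src e) z * ρ (D.tgt e) z) ^ 2 := fun z hz => by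
      rw [D.branch_sq e ((hball z hz).2 e he), mul_pow, hρ, hρ]
    obtain ⟨c, hc⟩ := exists_zmodTwoSign_mul (hsq z₀ hz₀r)
    refine ⟨c, fun _ z hz => ?_⟩
    refine (convex_ball z₀ r).isPreconnected.eq_of_sq_eq
      ((D.continuousOn_branch e).mono fun z hz => (hball z hz).2 e he)
      (continuousOn_const.mul ((hρc _).mul (hρc _))) (fun z hz => ?_) (fun {z} hz => ?_)
      hz₀r hc hz
    · simp only [Pi.pow_apply, Pi.mul_apply]
      rw [hsq z hz, mul_pow (zmodTwoSign c), zmodTwoSign_sq, one_mul]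
    · exact mul_ne_zero (zmodTwoSign_ne_zero _) (mul_ne_zero (hρ0 _ _ hz) (hρ0 _ _ hz))
  choose c hc using h4
  exact ⟨r, hr, ρ, c, hρc, hρ, fun z hz => (hball z hz).1,
    fun e he z hz => ⟨(hball z hz).2 e he, hc e he z hz⟩⟩

/-- Up to a coboundary, only the coordinate of e can vary near z₀, since all other arcs stay away.
-/
theorem exists_ball_face_eq {z₀ : ℂ} (hz₀ : z₀ ∉ Set.range D.pt) (e : E)
    (he : ∀ f, f ≠ e → z₀ ∉ Set.range (D.arc f)) :
    ∃ r > 0, ∀ z ∈ Metric.ball z₀ r, ∃ y : ZMod 2, D.face z = D.face z₀ + y • D.dual e := by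
  classical
  obtain ⟨r, hr, ρ, c, -, hρ, hpt, hbr⟩ := D.exists_local_branch hz₀
  have key : ∀ z ∈ Metric.ball z₀ r, ∃ y : ZMod 2,
      D.face z = Submodule.Quotient.mk c + y • D.dual e := fun z hz => by
    obtain ⟨x, hx⟩ := D.exists_theta_eq (hpt z hz) (fun v => ρ v z) (fun v => hρ v z)
    refine ⟨D.theta z e - c e - D.coboundary x e, ?_⟩
    have : D.theta z = c + D.coboundary x +
        (D.theta z e - c e - D.coboundary x e) • Pi.single e 1 := funext fun f => by
      by_cases hf : f = e
      · subst hf; simp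
      · simp [hf, hx f (c f) (hbr f (he f hf) z hz).1 (hbr f (he f hf) z hz).2]
    conv_lhs => rw [face, this]
    rw [Submodule.Quotient.mk_add, Submodule.Quotient.mk_add, mk_coboundary, add_zero,
      Submodule.Quotient.mk_smul, dual]
  obtain ⟨y₀, hy₀⟩ := key z₀ (Metric.mem_ball_self hr)
  refine ⟨r, hr, fun z hz => ?_⟩
  obtain ⟨y, hy⟩ := key z hz
  exact ⟨y - y₀, by rw [hy, hy₀, sub_smul]; abel⟩

/-- The class of the midpoint of an edge. -/
noncomputable def sideFace (e : E) : D.FaceSpace := D.face (D.arc e ⟨1 / 2, by norm_num, by norm_num⟩)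

/-- On the arc itself the branch has no meaningful sign, so classes are compared modulo `dual e`.
The local comparison propagates along the connected open arc. -/
theorem face_arc_eq (e : E) {t : unitInterval} (ht : t ∈ Set.Ioo (0 : unitInterval) 1) :
    ∃ y : ZMod 2, D.face (D.arc e t) = D.sideFace e + y • D.dual e := by
  have hloc : ∀ t ∈ Set.Ioo (0 : unitInterval) 1, ∀ᶠ s in 𝓝 t, ∃ y : ZMod 2,
      D.face (D.arc e s) = D.face (D.arc e t) + y • D.dual e := fun t ht => by
    obtain ⟨r, hr, h⟩ := D.exists_ball_face_eq (fun ⟨v, hv⟩ => D.arc_ne_pt e t ht v hv.symm) e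
      fun f hf => D.notMem_range_arc_of_ne hf ht
    filter_upwards [(D.arc_continuous e).continuousAt.preimage_mem_nhds
      (Metric.ball_mem_nhds _ hr)] with s hs using h _ hs
  let P : unitInterval → unitInterval → Prop := fun s t => ∃ y : ZMod 2,
      D.face (D.arc e t) = D.face (D.arc e s) + y • D.dual e
  have hsymm : ∀ s t, P s t → P t s := fun s t ⟨y, hy⟩ => ⟨-y, by rw [hy, neg_smul]; abel⟩
  refine isPreconnected_Ioo.induction₂ P (fun t ht => ?_) ?_ ?_
    (x := ⟨1 / 2, by norm_num, by norm_num⟩) (y := t) ?_ ht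
  · exact Filter.Eventually.filter_mono nhdsWithin_le_nhds (hloc t ht)
  · rintro s t u - - - ⟨y, hy⟩ ⟨y', hy'⟩
    exact ⟨y + y', by rw [hy', hy, add_smul]; abel⟩
  · intro s t _ _ h
    exact hsymm s t h
  · constructor <;> rw [← Subtype.coe_lt_coe] <;> norm_num

theorem exists_ball_face_eq_sideFace (e : E) {t : unitInterval}
    (ht : t ∈ Set.Ioo (0 : unitInterval) 1) :
    ∃ r > 0, ∀ z ∈ Metric.ball (D.arc e t) r, ∃ y : ZMod 2,
      D.face z = D.sideFace e + y • D.dual e := by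
  obtain ⟨r, hr, h⟩ := D.exists_ball_face_eq (fun ⟨v, hv⟩ => D.arc_ne_pt e t ht v hv.symm) e
      fun f hf => D.notMem_range_arc_of_ne hf ht
  refine ⟨r, hr, fun z hz => ?_⟩
  obtain ⟨y, hy⟩ := h z hz
  obtain ⟨y', hy'⟩ := D.face_arc_eq e ht
  exact ⟨y' + y, by rw [hy, hy', add_smul]; abel⟩

theorem dense_outside : Dense D.outside :=
  (dense_compl_iUnion_range D.arc D.arc_continuous D.arc_injective).sdiff_finite
    (Set.finite_range D.pt)

end Local

end ArcSystem

/-! ### Functions of faces and their jumps -/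

namespace ArcSystem

variable {V E : Type*} (D : ArcSystem V E)

/-- The change of `φ` across an edge. -/
noncomputable def jump (φ : D.FaceSpace → ZMod 2) (e : E) : ZMod 2 :=
  φ (D.sideFace e) + φ (D.sideFace e + D.dual e)

/-- On the coset of the at most two classes along e, any φ is affine over ℤ/2 with slope `jump φ e`.
-/
theorem jump_spec (φ : D.FaceSpace → ZMod 2) (e : E) (x y : ZMod 2) :
    φ (D.sideFace e + x • D.dual e + y • D.dual e) + D.jump φ e * y =
      φ (D.sideFace e + x • D.dual e) := by
  have h : ∀ x : ZMod 2, x = 0 ∨ x = 1 := by decide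
  have h2 : D.dual e + D.dual e = 0 := by
    rw [← two_smul (ZMod 2), show (2 : ZMod 2) = 0 by decide, zero_smul]
  rcases h x with rfl | rfl <;> rcases h y with rfl | rfl <;>
    simp [jump, add_assoc, h2]
  · rw [add_left_comm, CharTwo.add_self_eq_zero, add_zero]
  · rw [← add_assoc, CharTwo.add_self_eq_zero, zero_add]

variable [Fintype E]

/-- The edges across which `φ` changes. -/
noncomputable def support (φ : D.FaceSpace → ZMod 2) : Finset E :=
  Finset.univ.filter fun e => D.jump φ e = 1

theorem sum_support (φ : D.FaceSpace → ZMod 2) (η : E → ZMod 2) :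
    ∑ e ∈ D.support φ, η e = ∑ e, D.jump φ e * η e := by
  rw [support, Finset.sum_filter]
  refine Finset.sum_congr rfl fun e _ => ?_
  have h : ∀ x : ZMod 2, x = 0 ∨ x = 1 := by decide
  rcases h (D.jump φ e) with h | h <;> simp [h]

variable [Finite V]

/-- The product of the branches of the edges across which `φ` changes, with the sign of `φ`. -/
noncomputable def signedBranch (φ : D.FaceSpace → ZMod 2) (z : ℂ) : ℂ :=
  zmodTwoSign (φ (D.face z)) * ∏ e ∈ D.support φ, D.branch e z

/-- When z crosses e, the sign of the branch of e may flip. If φ jumps across e, its sign flips at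
the same time; if not, that branch is absent from the product. Either way the total sign ε stays
constant. -/
theorem exists_local_signedBranch (φ : D.FaceSpace → ZMod 2) {z₀ : ℂ}
    (hz₀ : z₀ ∉ Set.range D.pt) :
    ∃ r > 0, ∃ (ρ : V → ℂ → ℂ) (ε : ZMod 2),
      (∀ v, ContinuousOn (ρ v) (Metric.ball z₀ r)) ∧ (∀ v z, ρ v z ^ 2 = z - D.pt v) ∧
      ∀ z ∈ Metric.ball z₀ r, z ∈ D.outside → D.signedBranch φ z =
        zmodTwoSign ε * ∏ e ∈ D.support φ, (ρ (D.src e) z * ρ (D.tgt e) z) := by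
  classical
  obtain ⟨r, hr, ρ, c, hρc, hρ, hpt, hbr⟩ := D.exists_local_branch hz₀
  let g : (E → ZMod 2) → ZMod 2 := fun η =>
    φ (Submodule.Quotient.mk η) + ∑ e, D.jump φ e * η e
  have key : ∀ z ∈ D.outside, ∀ η : E → ZMod 2,
      (∀ e, D.branch e z = zmodTwoSign (η e) * (ρ (D.src e) z * ρ (D.tgt e) z)) →
      D.face z = Submodule.Quotient.mk η ∧ D.signedBranch φ z =
        zmodTwoSign (g η) * ∏ e ∈ D.support φ, (ρ (D.src e) z * ρ (D.tgt e) z) := by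
    intro z hz η hη
    have hf := D.face_eq_mk hz (fun v => ρ v z) (fun v => hρ v z) η hη
    refine ⟨hf, ?_⟩
    rw [signedBranch, hf, zmodTwoSign_add, ← sum_support, zmodTwoSign_sum, mul_assoc,
      ← Finset.prod_mul_distrib]
    simp only [hη]
  by_cases hex : ∃ e, z₀ ∈ Set.range (D.arc e)
  · obtain ⟨e, he⟩ := hex
    have hne : ∀ f, f ≠ e → z₀ ∉ Set.range (D.arc f) := fun f hf h =>
      hf (D.eq_of_mem_range hz₀ h he)
    obtain ⟨t, rfl⟩ := he
    obtain ⟨r', hr', hface⟩ :=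
      D.exists_ball_face_eq_sideFace e (D.mem_Ioo_of_notMem_range hz₀)
    refine ⟨min r r', lt_min hr hr', ρ, g (Function.update c e 0),
      fun v => (hρc v).mono (Metric.ball_subset_ball (min_le_left _ _)), hρ, fun z hz hzo => ?_⟩
    have hzr := Metric.ball_subset_ball (min_le_left _ _) hz
    obtain ⟨x, hx⟩ := hface z (Metric.ball_subset_ball (min_le_right _ _) hz)
    have hze : z ∉ Set.range (D.arc e) := fun h => hzo.1 (Set.mem_iUnion.2 ⟨e, h⟩)
    obtain ⟨y, hy⟩ : ∃ y, D.branch e z = zmodTwoSign y * (ρ (D.src e) z * ρ (D.tgt e) z) := by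
      apply exists_zmodTwoSign_mul
      rw [D.branch_sq e hze, mul_pow, hρ, hρ]
    have hη : ∀ f, D.branch f z =
        zmodTwoSign (Function.update c e y f) * (ρ (D.src f) z * ρ (D.tgt f) z) := fun f => by
      by_cases hf : f = e
      · subst hf; simpa using hy
      · simpa [hf] using (hbr f (hne f hf) z hzr).2
    obtain ⟨h1, h2⟩ := key z hzo _ hη
    rw [h2]
    congr 2
    have hup : Function.update c e y = Function.update c e 0 + y • Pi.single e 1 := by
      ext f
      by_cases hf : f = e
      · subst hf; simp
      · simp [hf]
    have h3 : (Submodule.Quotient.mk (Function.update c e y) : D.FaceSpace) =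
        Submodule.Quotient.mk (Function.update c e 0) + y • D.dual e := by
      rw [hup, Submodule.Quotient.mk_add, Submodule.Quotient.mk_smul, dual]
    -- This places the reference class in the coset along e, where `jump_spec` applies.
    have h4 : (Submodule.Quotient.mk (Function.update c e 0) : D.FaceSpace) =
        D.sideFace e + (x - y) • D.dual e := by
      rw [sub_smul, ← add_sub_assoc, ← hx, h1, h3]; abel
    have h5 : ∑ f, D.jump φ f * Function.update c e y f =
        ∑ f, D.jump φ f * Function.update c e 0 f + D.jump φ e * y := by
      rw [hup]
      simp only [Pi.add_apply, mul_add, Finset.sum_add_distrib, Pi.smul_apply, smul_eq_mul]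
      simp [Pi.single_apply]
    simp only [g]
    rw [h5, h3, h4, add_left_comm, ← D.jump_spec φ e (x - y) y]
    ring
  · push Not at hex
    refine ⟨r, hr, ρ, g c, hρc, hρ, fun z hz hzo => ?_⟩
    exact (key z hzo c fun e => (hbr e (hex e) z hz).2).2

/-- The local formula makes sense on the arcs too, so limits along the dense set `D.outside` exist
at every point that is not a vertex. Squaring removes the signs. -/
theorem exists_continuousOn_signedBranch (φ : D.FaceSpace → ZMod 2) :
    ∃ Ψ : ℂ → ℂ, ContinuousOn Ψ (Set.range D.pt)ᶜ ∧ (∀ z ∈ D.outside, Ψ z = D.signedBranch φ z) ∧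
      ∀ z, z ∉ Set.range D.pt →
        Ψ z ^ 2 = ∏ e ∈ D.support φ, ((z - D.pt (D.src e)) * (z - D.pt (D.tgt e))) := by
  have hlim : ∀ z, z ∉ Set.range D.pt → ∃ y, Filter.Tendsto (D.signedBranch φ) (𝓝[D.outside] z) (𝓝 y) ∧
      y ^ 2 = ∏ e ∈ D.support φ, ((z - D.pt (D.src e)) * (z - D.pt (D.tgt e))) ∧
      (z ∈ D.outside → y = D.signedBranch φ z) := by
    intro z hz
    obtain ⟨r, hr, ρ, ε, hρc, hρ, h⟩ := D.exists_local_signedBranch φ hz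
    have hb := Metric.ball_mem_nhds z hr
    refine ⟨zmodTwoSign ε * ∏ e ∈ D.support φ, (ρ (D.src e) z * ρ (D.tgt e) z), ?_, ?_, ?_⟩
    · have hc : ContinuousAt (fun z => zmodTwoSign ε *
          ∏ e ∈ D.support φ, (ρ (D.src e) z * ρ (D.tgt e) z)) z := by
        have : ∀ v, ContinuousAt (ρ v) z := fun v => (hρc v).continuousAt hb
        refine continuousAt_const.mul (tendsto_finsetProd _ fun e _ => (this _).mul (this _))
      refine (hc.tendsto.mono_left nhdsWithin_le_nhds).congr' ?_
      filter_upwards [nhdsWithin_le_nhds hb, self_mem_nhdsWithin] with w hw hwo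
      exact (h w hw hwo).symm
    · rw [mul_pow, zmodTwoSign_sq, one_mul, ← Finset.prod_pow]
      exact Finset.prod_congr rfl fun e _ => by rw [mul_pow, hρ, hρ]
    · exact fun hzo => (h z (Metric.mem_ball_self hr) hzo).symm
  have hext : ∀ z y, Filter.Tendsto (D.signedBranch φ) (𝓝[D.outside] z) (𝓝 y) →
      extendFrom D.outside (D.signedBranch φ) z = y := fun z y =>
    extendFrom_eq (D.dense_outside z)
  refine ⟨extendFrom D.outside (D.signedBranch φ), ?_, fun z hz => ?_, fun z hz => ?_⟩
  · exact continuousOn_extendFrom (fun z _ => D.dense_outside z)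
      fun z hz => (hlim z hz).imp fun y hy => hy.1
  · obtain ⟨y, h1, -, h3⟩ := hlim z hz.2
    rw [hext z y h1, h3 hz]
  · obtain ⟨y, h1, h2, -⟩ := hlim z hz
    rw [hext z y h1, h2]

/-- At a vertex of odd degree 2j + 1, dividing the extended product by (z - v)^j and by roots of the
remaining factors would leave a continuous √(z - v) on a punctured disc. -/
theorem even_card_support [DecidableEq V] (φ : D.FaceSpace → ZMod 2) (v : V) :
    Even ((D.support φ).filter fun e => D.src e = v ∨ D.tgt e = v).card := by
  obtain ⟨Ψ, hΨc, -, hΨ⟩ := D.exists_continuousOn_signedBranch φ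
  by_contra hodd
  obtain ⟨j, hj⟩ := Nat.not_even_iff_odd.1 hodd
  have hfin : (Set.range D.pt \ {D.pt v}).Finite := (Set.finite_range D.pt).subset Set.sdiff_subset
  obtain ⟨r, hr, hball⟩ := Metric.eventually_nhds_iff_ball.1
    (hfin.isClosed.isOpen_compl.mem_nhds (x := D.pt v) (by simp))
  have h3 : ∀ u, u ≠ v → r ≤ dist (D.pt u) (D.pt v) := fun u hu => by
    by_contra! h
    exact hball _ h ⟨⟨u, rfl⟩, fun h => hu (D.pt_injective h)⟩
  -- The value 1 at u = v drops the factors z - v, which have no root here and are counted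
  -- separately.
  have h4 : ∀ u, ∃ ρ : ℂ → ℂ, ContinuousOn ρ (Metric.ball (D.pt v) r) ∧
      ∀ z, ρ z ^ 2 = if u = v then 1 else z - D.pt u := fun u => by
    by_cases hu : u = v
    · exact ⟨fun _ => 1, continuousOn_const, by simp [hu]⟩
    · simpa [hu] using exists_sqrt_ball (D.pt u) (D.pt v) r (h3 u hu)
  choose ρ hρc hρ using h4
  let p : ℂ → ℂ := fun z => ∏ e ∈ D.support φ, (ρ (D.src e) z * ρ (D.tgt e) z)
  have hpc : ContinuousOn p (Metric.ball (D.pt v) r) :=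
    continuousOn_finsetProd _ fun e _ => (hρc _).mul (hρc _)
  have hp : ∀ z, p z ^ 2 * (z - D.pt v) ^ (2 * j + 1) =
      ∏ e ∈ D.support φ, ((z - D.pt (D.src e)) * (z - D.pt (D.tgt e))) := fun z => by
    rw [← hj, ← Finset.prod_const, Finset.prod_filter, ← Finset.prod_pow,
      ← Finset.prod_mul_distrib]
    refine Finset.prod_congr rfl fun e _ => ?_
    have hst := D.src_ne_tgt e
    rw [mul_pow, hρ, hρ]
    by_cases h1 : D.src e = v
    · have h2 : D.tgt e ≠ v := fun h => hst (h1.trans h.symm)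
      simp [h1, h2, mul_comm]
    · by_cases h2 : D.tgt e = v <;> simp [h1, h2]
  have hz : ∀ z ∈ Metric.ball (D.pt v) r \ {D.pt v}, z ∉ Set.range D.pt := fun z hz h =>
    hball z hz.1 ⟨h, hz.2⟩
  have hp0 : ∀ z ∈ Metric.ball (D.pt v) r \ {D.pt v}, p z ≠ 0 := fun z hzz h0 => by
    have := hp z
    rw [h0] at this
    simp only [ne_eq, OfNat.ofNat_ne_zero, not_false_eq_true, zero_pow, zero_mul] at this
    obtain ⟨e, -, he⟩ := Finset.prod_eq_zero_iff.1 this.symm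
    rcases mul_eq_zero.1 he with h | h
    · exact hz z hzz ⟨_, (sub_eq_zero.1 h).symm⟩
    · exact hz z hzz ⟨_, (sub_eq_zero.1 h).symm⟩
  have hzv : ∀ z ∈ Metric.ball (D.pt v) r \ {D.pt v}, z - D.pt v ≠ 0 := fun z hz h =>
    hz.2 (sub_eq_zero.1 h)
  refine not_exists_sqrt_punctured_ball (D.pt v) r hr (fun z => Ψ z / (p z * (z - D.pt v) ^ j))
    ?_ fun z hzz => ?_
  · refine (hΨc.mono fun z h => hz z h).div ((hpc.mono Set.sdiff_subset).mul (by fun_prop)) ?_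
    exact fun z h => mul_ne_zero (hp0 z h) (pow_ne_zero _ (hzv z h))
  · have h1 := hp0 z hzz
    have h2 := hzv z hzz
    rw [div_pow, hΨ z (hz z hzz), ← hp z]
    field_simp
    ring

/-- Without jumps the product is empty, so the sign of φ itself extends continuously with square 1
to the plane minus finitely many points, which is connected. -/
theorem apply_face_eq (φ : D.FaceSpace → ZMod 2) (h : ∀ e, D.jump φ e = 0) {z w : ℂ}
    (hz : z ∈ D.outside) (hw : w ∈ D.outside) : φ (D.face z) = φ (D.face w) := by
  obtain ⟨Ψ, hΨc, hΨo, hΨ⟩ := D.exists_continuousOn_signedBranch φ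
  have hs : D.support φ = ∅ := by simp [support, h]
  simp only [hs, Finset.prod_empty, signedBranch, mul_one] at hΨ hΨo
  have hconn : IsPreconnected (Set.range D.pt)ᶜ :=
    ((Set.finite_range D.pt).countable.isConnected_compl_of_one_lt_rank
      (by rw [Complex.rank_real_complex]; exact Nat.one_lt_ofNat)).isPreconnected
  apply zmodTwoSign_injective
  rw [← hΨo z hz, ← hΨo w hw]
  have h0 : ∀ z, z ∉ Set.range D.pt → Ψ z ≠ 0 := fun z hz h0 => by
    have := hΨ z hz
    simp [h0] at this
  refine hconn.eq_of_sq_eq (g := fun _ => Ψ w) hΨc continuousOn_const (fun x hx => ?_)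
    (fun _ => h0 w hw.2) (y := w) hw.2 rfl hz.2
  simp [hΨ x hx, hΨ w hw.2]

end ArcSystem

/-! ### Face boundaries and Euler's inequality -/

namespace ArcSystem

universe w

variable {V : Type*} {E : Type w} (D : ArcSystem V E)

theorem dual_add_dual (e : E) : D.dual e + D.dual e = 0 := by
  rw [← two_smul (ZMod 2), show (2 : ZMod 2) = 0 by decide, zero_smul]

/-- A face is incident with an edge if it is one of the two distinct faces along the edge. -/
def Incident (q : D.FaceSpace) (e : E) : Prop :=
  D.dual e ≠ 0 ∧ (q = D.sideFace e ∨ q = D.sideFace e + D.dual e)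

variable {D} in
theorem Incident.iff_eq {q : D.FaceSpace} {e : E} (h : D.Incident q e) (q' : D.FaceSpace) :
    D.Incident q' e ↔ q' = q ∨ q' = q + D.dual e := by
  obtain ⟨h0, rfl | rfl⟩ := h
  · simp [Incident, h0]
  · simp [Incident, h0, add_assoc, dual_add_dual, or_comm]

open Classical in
-- This identifies the boundary of q with the support of its indicator function, so that
-- `even_card_support` applies to it.
theorem jump_eq_one_iff (q : D.FaceSpace) (e : E) :
    D.jump (fun q' => if q' = q then 1 else 0) e = 1 ↔ D.Incident q e := by
  unfold jump Incident
  by_cases h0 : D.dual e = 0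
  · simp [h0, CharTwo.add_self_eq_zero]
  · by_cases h1 : D.sideFace e = q
    · subst h1
      simp [h0]
    · by_cases h2 : D.sideFace e + D.dual e = q
      · simp [h0, h1, h2]
      · simp [h1, h2, Ne.symm h1, Ne.symm h2]

theorem span_range_dual [Finite E] : Submodule.span (ZMod 2) (Set.range D.dual) = ⊤ := by
  classical
  rw [eq_top_iff]
  rintro q -
  obtain ⟨η, rfl⟩ := Submodule.Quotient.mk_surjective _ q
  cases nonempty_fintype E
  have : η = ∑ e, η e • Pi.single e (1 : ZMod 2) := by
    ext f; simp [Pi.single_apply]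
  rw [this, ← Submodule.mkQ_apply, map_sum]
  refine Submodule.sum_mem _ fun e _ => ?_
  rw [map_smul]
  exact Submodule.smul_mem _ _ (Submodule.subset_span ⟨e, rfl⟩)

/-- The constant function 1 lies in the kernel of the coboundary, so the cut space has dimension at
most |V| - 1. -/
theorem card_add_one_le_finrank_add_card [Fintype V] [Fintype E] [Nonempty V] :
    Fintype.card E + 1 ≤ Module.finrank (ZMod 2) D.FaceSpace + Fintype.card V := by
  have h1 := Submodule.finrank_quotient_add_finrank (LinearMap.range D.coboundary)
  have h2 := LinearMap.finrank_range_add_finrank_ker D.coboundary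
  have h3 : 0 < Module.finrank (ZMod 2) (LinearMap.ker D.coboundary) := by
    rw [Module.finrank_pos_iff_exists_ne_zero]
    refine ⟨⟨fun _ => 1, ?_⟩, fun h => ?_⟩
    · rw [LinearMap.mem_ker]
      ext e
      simp [coboundary, CharTwo.add_self_eq_zero]
    · obtain ⟨v⟩ := ‹Nonempty V›
      simpa using congrFun (congrArg Subtype.val h) v
  rw [Module.finrank_fintype_fun_eq_card] at h1 h2
  change Module.finrank (ZMod 2) D.FaceSpace + _ = _ at h1
  omega

theorem exists_outside_face_eq [Finite V] [Finite E] (e : E) :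
    ∃ z ∈ D.outside, ∃ y : ZMod 2, D.face z = D.sideFace e + y • D.dual e := by
  obtain ⟨r, hr, h⟩ := D.exists_ball_face_eq_sideFace e
    (t := ⟨1 / 2, by norm_num, by norm_num⟩) (by
      constructor <;> rw [← Subtype.coe_lt_coe] <;> norm_num)
  obtain ⟨z, hz, hzo⟩ := Metric.dense_iff.1 D.dense_outside _ r hr
  exact ⟨z, hzo, h z hz⟩

/-- The indicator of {p, q} has no jumps, so it is constant on the classes of points off the
drawing. Points near e₀ give the value 1, hence so do points near e, and both faces along e are
among p and q. -/
theorem eq_or_eq_of_incident_iff [Finite V] [Finite E] {p q k : D.FaceSpace} (hpq : p ≠ q)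
    (h : ∀ e, D.Incident p e ↔ D.Incident q e) {e₀ e : E} (he₀ : D.Incident p e₀)
    (hk : D.Incident k e) : k = p ∨ k = q := by
  classical
  cases nonempty_fintype E
  have hq : ∀ {e}, D.Incident p e → ∀ q', D.Incident q' e ↔ q' = p ∨ q' = q := by
    intro e he q'
    have h1 := ((he.iff_eq q).1 ((h e).1 he)).resolve_left hpq.symm
    rw [he.iff_eq, h1]
  have hside : ∀ e (y : ZMod 2), D.dual e ≠ 0 → D.Incident (D.sideFace e + y • D.dual e) e := by
    have h : ∀ x : ZMod 2, x = 0 ∨ x = 1 := by decide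
    intro e y h0
    rcases h y with rfl | rfl <;> simp [Incident, h0]
  let φ : D.FaceSpace → ZMod 2 := fun q' => if q' = p ∨ q' = q then 1 else 0
  have hφ1 : ∀ q', φ q' = 1 ↔ q' = p ∨ q' = q := fun q' => by
    simp only [φ]; split_ifs with h <;> simp [h]
  have hφ : ∀ e, D.jump φ e = 0 := by
    intro e
    by_cases h0 : D.dual e = 0
    · simp [jump, h0, CharTwo.add_self_eq_zero]
    have key : ∀ q', D.Incident q' e → (φ q' = 1 ↔ D.Incident p e) := fun q' hq' => by
      rw [hφ1]
      constructor
      · rintro (rfl | rfl)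
        · exact hq'
        · exact (h e).2 hq'
      · exact fun hp => (hq hp q').1 hq'
    have h1 := key (D.sideFace e) ⟨h0, .inl rfl⟩
    have h2 := key (D.sideFace e + D.dual e) ⟨h0, .inr rfl⟩
    have h3 : ∀ x y : ZMod 2, (x = 1 ↔ y = 1) → x + y = 0 := by decide
    exact h3 _ _ (h1.trans h2.symm)
  obtain ⟨z₀, hz₀, y₀, hy₀⟩ := D.exists_outside_face_eq e₀
  obtain ⟨z, hz, y, hy⟩ := D.exists_outside_face_eq e
  have h1 := (hq he₀ _).1 (hside e₀ y₀ he₀.1)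
  rw [← hy₀, ← hφ1, D.apply_face_eq φ hφ hz₀ hz, hφ1] at h1
  have h2 := hside e y hk.1
  rw [← hy] at h2
  have h3 : D.Incident p e := by
    rcases h1 with h1 | h1
    · exact h1 ▸ h2
    · exact (h e).2 (h1 ▸ h2)
  exact (hq h3 k).1 hk

/-- The boundaries of the faces of a plane drawing: even edge sets that cover every edge not at all
or twice, of which there are enough for the lower bound in Euler's formula. -/
theorem exists_faces [Fintype V] [DecidableEq V] [Fintype E] [Nonempty V] :
    ∃ (ι : Type w) (_ : Fintype ι) (S : ι → Finset E), (∀ i, (S i).Nonempty) ∧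
      (∀ i v, Even ((S i).filter fun e => D.src e = v ∨ D.tgt e = v).card) ∧
      (∀ i e, e ∈ S i → ∃ j, j ≠ i ∧ ∀ k, e ∈ S k ↔ k = i ∨ k = j) ∧
      (∀ i j, i ≠ j → S i = S j → ∀ k, k = i ∨ k = j) ∧
      (Fintype.card E + 2 ≤ Fintype.card ι + Fintype.card V ∨
        Fintype.card E + 1 ≤ Fintype.card V) := by
  classical
  have : Finite D.FaceSpace := Finite.of_surjective _ (Submodule.mkQ_surjective _)
  let ι := {q : D.FaceSpace // ∃ e, D.Incident q e}
  have : Fintype ι := Fintype.ofFinite ι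
  let S : ι → Finset E := fun i => Finset.univ.filter fun e => D.Incident i e
  have hι : ∀ i j : ι, i = j ↔ i.1 = j.1 := fun _ _ => Subtype.ext_iff
  have hS : ∀ i e, e ∈ S i ↔ D.Incident i e := by simp [S]
  refine ⟨ι, this, S, fun i => ?_, fun i v => ?_, fun i e he => ?_, fun i j hij h k => ?_, ?_⟩
  · obtain ⟨e, he⟩ := i.2
    exact ⟨e, (hS i e).2 he⟩
  · convert D.even_card_support (fun q' => if q' = i.1 then 1 else 0) v using 3
    ext e
    rw [hS, support, Finset.mem_filter, jump_eq_one_iff]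
    simp
  · rw [hS] at he
    have h1 : D.Incident (i.1 + D.dual e) e := (he.iff_eq _).2 (.inr rfl)
    refine ⟨⟨_, e, h1⟩, fun h => ?_, fun k => ?_⟩
    · have := congrArg Subtype.val h
      exact he.1 (by simpa using this)
    · rw [hS, he.iff_eq, hι, hι]
  · obtain ⟨e₀, he₀⟩ := i.2
    obtain ⟨e, he⟩ := k.2
    have := D.eq_or_eq_of_incident_iff (p := i.1) (q := j.1) (fun h => hij (Subtype.ext h))
      (fun e => by rw [← hS, ← hS, h]) he₀ he
    rwa [hι, hι]
  · have h1 := D.card_add_one_le_finrank_add_card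
    rcases isEmpty_or_nonempty ι with hι | ⟨⟨i₀⟩⟩
    -- No face means that every edge class vanishes; these classes span, so the quotient is zero.
    · right
      have hd : ∀ e, D.dual e = 0 := fun e => by
        by_contra h
        exact hι.false ⟨D.sideFace e, e, h, .inl rfl⟩
      have h2 := D.span_range_dual
      have h3 : Submodule.span (ZMod 2) (Set.range D.dual) = ⊥ := by
        rw [Submodule.span_eq_bot]; rintro _ ⟨e, rfl⟩; exact hd e
      have h4 : Module.finrank (ZMod 2) D.FaceSpace = 0 := by
        rw [← finrank_top, ← h2, h3, finrank_bot]
      omega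
    · left
      have hc : 0 < Fintype.card ι := Fintype.card_pos_iff.2 ⟨i₀⟩
      -- The |F| faces span an affine subspace of dimension at most |F| - 1. Its direction contains
      -- every `dual e`, a difference of two faces or zero, and so is the whole space.
      have h2 := finrank_vectorSpan_range_le (ZMod 2) (Subtype.val : ι → D.FaceSpace)
        (n := Fintype.card ι - 1) (Nat.sub_add_cancel hc).symm
      have h3 : vectorSpan (ZMod 2) (Set.range (Subtype.val : ι → D.FaceSpace)) = ⊤ := by
        rw [eq_top_iff, ← D.span_range_dual, Submodule.span_le]
        rintro _ ⟨e, rfl⟩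
        by_cases h0 : D.dual e = 0
        · rw [h0]; exact Submodule.zero_mem _
        · have := vsub_mem_vectorSpan (ZMod 2)
            (Set.mem_range_self (f := (Subtype.val : ι → D.FaceSpace))
              ⟨D.sideFace e + D.dual e, e, h0, .inr rfl⟩)
            (Set.mem_range_self (f := (Subtype.val : ι → D.FaceSpace))
              ⟨D.sideFace e, e, h0, .inl rfl⟩)
          simpa using this
      rw [h3, finrank_top] at h2
      omega

end ArcSystem

/-! ### Discharging -/

theorem two_mul_card_le_of_discharging {ι E : Type*} [Fintype ι] [Fintype E] [DecidableEq E]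
    (S : ι → Finset E) (h3 : ∀ i, 3 ≤ (S i).card)
    (hpair : ∀ i e, e ∈ S i → ∃ j, j ≠ i ∧ ∀ k, e ∈ S k ↔ k = i ∨ k = j)
    (h6 : ∀ i j e, i ≠ j → e ∈ S i → e ∈ S j → (S i).card = 3 → 6 ≤ (S j).card) :
    2 * Fintype.card ι ≤ Fintype.card E := by
  classical
  -- A triangle gets 3 · 4, a face with at least six edges gets at least 6 · 2, and a face with four
  -- or five edges borders no triangle and gets at least 4 · 3.
  let w : ι → E → ℕ := fun i e => if (S i).card = 3 then 4 else
    if ∃ j, j ≠ i ∧ e ∈ S j ∧ (S j).card = 3 then 2 else 3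
  have hw2 : ∀ i e, 2 ≤ w i e := fun i e => by simp only [w]; split_ifs <;> norm_num
  have hface : ∀ i, 12 ≤ ∑ e ∈ S i, w i e := by
    intro i
    by_cases hi3 : (S i).card = 3
    · simp [w, hi3]
    by_cases hi6 : 6 ≤ (S i).card
    · have : _ ≤ ∑ e ∈ S i, w i e := Finset.card_nsmul_le_sum (S i) (w i) 2 fun e _ => hw2 i e
      simp only [smul_eq_mul] at this
      omega
    · have : _ ≤ ∑ e ∈ S i, w i e := Finset.card_nsmul_le_sum (S i) (w i) 3 fun e he => by
        have : ¬ ∃ j, j ≠ i ∧ e ∈ S j ∧ (S j).card = 3 := fun ⟨j, hj, hej, hj3⟩ =>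
          hi6 (h6 j i e hj hej he hj3)
        simp [w, hi3, this]
      simp only [smul_eq_mul] at this
      have := h3 i
      omega
  have hedge : ∀ e, ∑ i ∈ Finset.univ.filter (fun i => e ∈ S i), w i e ≤ 6 := by
    intro e
    by_cases h : ∃ i, e ∈ S i
    · obtain ⟨i, hi⟩ := h
      obtain ⟨j, hji, hk⟩ := hpair i e hi
      have hj : e ∈ S j := (hk j).2 (.inr rfl)
      have : Finset.univ.filter (fun i => e ∈ S i) = {i, j} := by ext k; simp [hk]
      rw [this, Finset.sum_pair hji.symm]
      by_cases hi3 : (S i).card = 3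
      · have hj3 : (S j).card ≠ 3 := fun h => by have := h6 i j e hji.symm hi hj hi3; omega
        have : ∃ k, k ≠ j ∧ e ∈ S k ∧ (S k).card = 3 := ⟨i, hji.symm, hi, hi3⟩
        simp [w, hi3, hj3, this]
      · by_cases hj3 : (S j).card = 3
        · have : ∃ k, k ≠ i ∧ e ∈ S k ∧ (S k).card = 3 := ⟨j, hji, hj, hj3⟩
          simp [w, hi3, hj3, this]
        · simp only [w, hi3, hj3, if_false]
          split_ifs <;> norm_num
    · push Not at h
      simp [h]
  have h1 : 12 * Fintype.card ι ≤ ∑ i, ∑ e ∈ S i, w i e := by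
    have := Finset.card_nsmul_le_sum Finset.univ (fun i => ∑ e ∈ S i, w i e) 12 fun i _ => hface i
    simpa [mul_comm] using this
  have h2 : ∑ i, ∑ e ∈ S i, w i e = ∑ e, ∑ i ∈ Finset.univ.filter (fun i => e ∈ S i), w i e :=
    Finset.sum_comm' (by simp)
  have h3 := Finset.sum_le_card_nsmul Finset.univ
    (fun e => ∑ i ∈ Finset.univ.filter (fun i => e ∈ S i), w i e) 6 fun e _ => hedge e
  simp only [Finset.card_univ, smul_eq_mul] at h3
  omega

/-! ### Even edge sets and short cycles next to a triangle -/

namespace SimpleGraph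

variable {V : Type*} {G : SimpleGraph V}

theorem eq_of_not_hasTriangleAdjacentToCycle_three (h3 : ¬ G.HasTriangleAdjacentToCycle 3)
    {a b c d : V} (hab : G.Adj a b) (hbc : G.Adj b c) (hca : G.Adj c a) (hbd : G.Adj b d)
    (hda : G.Adj d a) : d = c := by
  by_contra hdc
  refine h3 ⟨a, a, .cons hab (.cons hbc (.cons hca .nil)), .cons hab (.cons hbd (.cons hda .nil)),
    rfl, rfl, ?_, ?_, ?_, s(a, b), by simp, by simp⟩
  · have := hab.ne; have := hbc.ne; have := hca.ne
    simp [Walk.cons_isCycle_iff]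
    grind
  · have := hab.ne; have := hbd.ne; have := hda.ne
    simp [Walk.cons_isCycle_iff]
    grind
  · intro h
    have h1 : d ∈ (Walk.cons hab (.cons hbd (.cons hda .nil))).toSubgraph.verts := by
      simp
    rw [← h, Walk.mem_verts_toSubgraph] at h1
    have := hbd.ne; have := hda.ne
    simp at h1
    grind

/-- The vertex c may lie on the 5-cycle; the two cycles still differ, because x and y cannot both
equal c. -/
theorem false_of_not_hasTriangleAdjacentToCycle_five (h5 : ¬ G.HasTriangleAdjacentToCycle 5)
    {a b c x y z : V} (hab : G.Adj a b) (hbc : G.Adj b c) (hca : G.Adj c a) (hbx : G.Adj b x)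
    (hxy : G.Adj x y) (hyz : G.Adj y z) (hza : G.Adj z a) (hn : [a, b, x, y, z].Nodup) :
    False := by
  simp only [List.nodup_cons, List.mem_cons, List.not_mem_nil] at hn
  refine h5 ⟨a, a, .cons hab (.cons hbc (.cons hca .nil)),
    .cons hab (.cons hbx (.cons hxy (.cons hyz (.cons hza .nil)))),
    rfl, rfl, ?_, ?_, ?_, s(a, b), by simp, by simp⟩
  · have := hab.ne; have := hbc.ne; have := hca.ne
    simp [Walk.cons_isCycle_iff]
    grind
  · simp [Walk.cons_isCycle_iff]
    grind
  · intro h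
    have h1 : ∀ u ∈ [x, y], u ∈
        (Walk.cons hab (.cons hbx (.cons hxy (.cons hyz (.cons hza .nil))))).toSubgraph.verts := by
      simp
    rw [← h] at h1
    simp only [Walk.mem_verts_toSubgraph] at h1
    simp at h1
    grind

variable [DecidableEq V]

/-- A finite set of edges of `G` that meets every vertex an even number of times. -/
def IsEvenEdgeSet (G : SimpleGraph V) (T : Finset (Sym2 V)) : Prop :=
  (∀ e ∈ T, e ∈ G.edgeSet) ∧ ∀ v, Even (T.filter fun e => v ∈ e).card

namespace IsEvenEdgeSet

variable {T U : Finset (Sym2 V)}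

theorem adj (hT : G.IsEvenEdgeSet T) {a b : V} (h : s(a, b) ∈ T) : G.Adj a b := hT.1 _ h

theorem exists_next (hT : G.IsEvenEdgeSet T) {a b : V} (h : s(a, b) ∈ T) :
    ∃ c, c ≠ a ∧ s(b, c) ∈ T := by
  have h1 : s(a, b) ∈ T.filter fun e => b ∈ e := by simp [h]
  have h2 : 1 < (T.filter fun e => b ∈ e).card := by
    obtain ⟨k, hk⟩ := hT.2 b
    have := Finset.card_pos.2 ⟨_, h1⟩
    omega
  obtain ⟨e, he, hne⟩ := Finset.exists_mem_ne h2 s(a, b)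
  obtain ⟨heT, hbe⟩ := Finset.mem_filter.1 he
  obtain ⟨c, rfl⟩ := Sym2.mem_iff_exists.1 hbe
  exact ⟨c, fun h => hne (h ▸ Sym2.eq_swap), heT⟩

theorem three_le_card (hT : G.IsEvenEdgeSet T) {a b : V} (h : s(a, b) ∈ T) : 3 ≤ T.card := by
  obtain ⟨x, hxa, hx⟩ := hT.exists_next h
  obtain ⟨y, hyb, hy⟩ := hT.exists_next hx
  have h1 := (hT.adj h).ne
  have h2 := (hT.adj hx).ne
  have h3 := (hT.adj hy).ne
  have : ({s(a, b), s(b, x), s(x, y)} : Finset (Sym2 V)).card = 3 := by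
    rw [Finset.card_eq_three]
    refine ⟨_, _, _, ?_, ?_, ?_, rfl⟩ <;> grind [Sym2.eq_iff]
  rw [← this]
  exact Finset.card_le_card (by grind)

theorem sdiff (hT : G.IsEvenEdgeSet T) (hU : G.IsEvenEdgeSet U) (h : U ⊆ T) :
    G.IsEvenEdgeSet (T \ U) := by
  refine ⟨fun e he => hT.1 e (Finset.sdiff_subset he), fun v => ?_⟩
  have h1 : (T \ U).filter (fun e => v ∈ e) = T.filter (fun e => v ∈ e) \ U.filter (fun e => v ∈ e) := by
    ext e; simp only [Finset.mem_filter, Finset.mem_sdiff]; tauto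
  rw [h1, Finset.card_sdiff_of_subset (Finset.filter_subset_filter _ h)]
  exact (Nat.even_sub (Finset.card_le_card (Finset.filter_subset_filter _ h))).2
    (iff_of_true (hT.2 v) (hU.2 v))

/-- The difference is again even, and a nonempty even edge set has at least three edges. -/
theorem eq_of_subset (hT : G.IsEvenEdgeSet T) (hU : G.IsEvenEdgeSet U) (h : U ⊆ T)
    (hc : T.card < U.card + 3) : T = U := by
  by_contra hne
  have h1 : (T \ U).Nonempty :=
    Finset.sdiff_nonempty.2 fun h' => hne (h'.antisymm h)
  obtain ⟨e, he⟩ := h1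
  induction e using Sym2.ind with
  | _ a b =>
    have := (hT.sdiff hU h).three_le_card he
    rw [Finset.card_sdiff_of_subset h] at this
    omega

theorem triangle {a b c : V} (hab : G.Adj a b) (hbc : G.Adj b c) (hca : G.Adj c a) :
    G.IsEvenEdgeSet {s(a, b), s(b, c), s(c, a)} ∧
      ({s(a, b), s(b, c), s(c, a)} : Finset (Sym2 V)).card = 3 := by
  have h1 := hab.ne
  have h2 := hbc.ne
  have h3 := hca.ne
  refine ⟨⟨by simp [hab, hbc, hca], fun v => ?_⟩, ?_⟩
  · by_cases va : v = a <;> by_cases vb : v = b <;> by_cases vc : v = c <;>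
      simp_all [Finset.filter_insert, Finset.filter_singleton, Finset.card_insert_of_notMem]
    all_goals
      rw [Finset.card_pair (by grind [Sym2.eq_iff])]
      exact even_two
  · rw [Finset.card_eq_three]
    refine ⟨_, _, _, ?_, ?_, ?_, rfl⟩ <;> grind [Sym2.eq_iff]

theorem quadrilateral {a b c d : V} (hab : G.Adj a b) (hbc : G.Adj b c) (hcd : G.Adj c d)
    (hda : G.Adj d a) (hac : a ≠ c) (hbd : b ≠ d) :
    G.IsEvenEdgeSet {s(a, b), s(b, c), s(c, d), s(d, a)} ∧
      ({s(a, b), s(b, c), s(c, d), s(d, a)} : Finset (Sym2 V)).card = 4 := by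
  have h1 := hab.ne
  have h2 := hbc.ne
  have h3 := hcd.ne
  have h4 := hda.ne
  refine ⟨⟨by simp [hab, hbc, hcd, hda], fun v => ?_⟩, ?_⟩
  · by_cases va : v = a <;> by_cases vb : v = b <;> by_cases vc : v = c <;> by_cases vd : v = d <;>
      simp_all [Finset.filter_insert, Finset.filter_singleton, Finset.card_insert_of_notMem]
    all_goals
      rw [Finset.card_pair (by grind [Sym2.eq_iff])]
      exact even_two
  · rw [Finset.card_eq_succ]
    refine ⟨_, _, ?_, rfl, ?_⟩
    · grind [Sym2.eq_iff]
    · rw [Finset.card_eq_three]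
      refine ⟨_, _, _, ?_, ?_, ?_, rfl⟩ <;> grind [Sym2.eq_iff]

/-- An even edge set with at most five edges is a cycle through any of its edges. -/
theorem eq_cycle (hT : G.IsEvenEdgeSet T) {a b : V} (h : s(a, b) ∈ T) (hc : T.card ≤ 5) :
    (∃ x, G.Adj b x ∧ G.Adj x a ∧ T = {s(a, b), s(b, x), s(x, a)}) ∨
    (∃ x y, G.Adj b x ∧ G.Adj x y ∧ G.Adj y a ∧ a ≠ x ∧ b ≠ y ∧ T.card = 4) ∨
    (∃ x y z, G.Adj b x ∧ G.Adj x y ∧ G.Adj y z ∧ G.Adj z a ∧ [a, b, x, y, z].Nodup ∧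
      T.card = 5) := by
  have hab := hT.adj h
  -- Even degrees allow a walk a, b, x, y, z, w in T that never backtracks. Once it closes up, fewer
  -- than three edges remain, so the cycle is all of T.
  obtain ⟨x, hxa, hx⟩ := hT.exists_next h
  have hbx := hT.adj hx
  obtain ⟨y, hyb, hy⟩ := hT.exists_next hx
  have hxy := hT.adj hy
  by_cases hya : y = a
  · subst hya
    obtain ⟨h1, h2⟩ := triangle hab hbx hxy
    refine .inl ⟨x, hbx, hxy, hT.eq_of_subset h1 ?_ (by omega)⟩
    simp [Finset.insert_subset_iff, *]
  obtain ⟨z, hzx, hz⟩ := hT.exists_next hy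
  have hyz := hT.adj hz
  by_cases hza : z = a
  · subst hza
    obtain ⟨h1, h2⟩ := quadrilateral hab hbx hxy hyz (Ne.symm hxa) (Ne.symm hyb)
    refine .inr (.inl ⟨x, y, hbx, hxy, hyz, Ne.symm hxa, Ne.symm hyb, ?_⟩)
    rw [hT.eq_of_subset h1 (by simp [Finset.insert_subset_iff, *]) (by omega), h2]
  -- Otherwise the triangle b, x, y would be all of T and miss the edge ab.
  have hzb : z ≠ b := by
    rintro rfl
    obtain ⟨h1, h2⟩ := triangle hbx hxy hyz
    have := hT.eq_of_subset h1 (by simp [Finset.insert_subset_iff, *]) (by omega)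
    rw [this] at h
    have h3 := hab.ne
    grind [Sym2.eq_iff]
  obtain ⟨w, hwy, hw⟩ := hT.exists_next hz
  have hzw := hT.adj hw
  have n1 := hab.ne
  have n2 := hbx.ne
  have n3 := hxy.ne
  have n4 := hyz.ne
  have n5 := hzw.ne
  have hcard : ({s(a, b), s(b, x), s(x, y), s(y, z), s(z, w)} : Finset (Sym2 V)).card = 5 := by
    rw [Finset.card_eq_succ]
    refine ⟨_, _, ?_, rfl, ?_⟩
    · grind [Sym2.eq_iff]
    rw [Finset.card_eq_succ]
    refine ⟨_, _, ?_, rfl, ?_⟩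
    · grind [Sym2.eq_iff]
    rw [Finset.card_eq_three]
    refine ⟨_, _, _, ?_, ?_, ?_, rfl⟩ <;> grind [Sym2.eq_iff]
  have hTeq := (Finset.eq_of_subset_of_card_le
    (s := {s(a, b), s(b, x), s(x, y), s(y, z), s(z, w)}) (t := T)
    (by simp [Finset.insert_subset_iff, *]) (by omega))
  by_cases hwa : w = a
  · subst hwa
    refine .inr (.inr ⟨x, y, z, hbx, hxy, hyz, hzw, ?_, by rw [← hTeq, hcard]⟩)
    simp only [List.nodup_cons, List.mem_cons, List.not_mem_nil]
    grind
  -- The five edges of the walk exhaust T, and ab is the only one at a, against evenness.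
  · exfalso
    obtain ⟨c, hcb, hc⟩ := hT.exists_next (a := b) (b := a) (Sym2.eq_swap ▸ h)
    rw [← hTeq] at hc
    grind [Sym2.eq_iff]

end IsEvenEdgeSet

/-- If no triangle is adjacent to a cycle of length `3` or `5`, then an even edge set that shares
an edge with a triangle has at least six edges. -/
theorem IsEvenEdgeSet.six_le_card (h3 : ¬ G.HasTriangleAdjacentToCycle 3)
    (h5 : ¬ G.HasTriangleAdjacentToCycle 5) {T U : Finset (Sym2 V)} (hT : G.IsEvenEdgeSet T)
    (hU : G.IsEvenEdgeSet U) (hTU : T ≠ U) (hc : T.card = 3) {e : Sym2 V} (heT : e ∈ T)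
    (heU : e ∈ U) : 6 ≤ U.card := by
  by_contra hlt
  induction e using Sym2.ind with
  | _ a b =>
  have hab := hT.adj heT
  rcases hT.eq_cycle heT (by omega) with ⟨c, hbc, hca, rfl⟩ | ⟨_, _, _, _, _, _, _, h⟩ |
    ⟨_, _, _, _, _, _, _, _, h⟩
  rotate_left
  · omega
  · omega
  rcases hU.eq_cycle heU (by omega) with ⟨x, hbx, hxa, rfl⟩ | ⟨x, y, hbx, hxy, hya, hax, hby, -⟩ |
    ⟨x, y, z, hbx, hxy, hyz, hza, hn, -⟩
  · obtain rfl := eq_of_not_hasTriangleAdjacentToCycle_three h3 hab hbc hca hbx hxa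
    exact hTU rfl
  -- If c is on the quadrilateral, its edge to a or b is a diagonal, and two triangles share an
  -- edge.
  · by_cases hxc : x = c
    · subst hxc
      exact hby (eq_of_not_hasTriangleAdjacentToCycle_three h3 hca hab hbc hya.symm hxy.symm).symm
    by_cases hyc : y = c
    · subst hyc
      exact hax (eq_of_not_hasTriangleAdjacentToCycle_three h3 hbc hca hab hxy.symm hbx.symm).symm
    -- Replacing the edge ab of the quadrilateral by the path a, c, b gives a 5-cycle that shares
    -- the edge ac with the triangle.
    refine false_of_not_hasTriangleAdjacentToCycle_five h5 hca.symm hbc.symm hab.symm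
      hbc.symm hbx hxy hya ?_
    have := hab.ne; have := hbc.ne; have := hca.ne; have := hbx.ne; have := hxy.ne
    have := hya.ne
    simp only [List.nodup_cons, List.mem_cons, List.not_mem_nil]
    grind
  · exact false_of_not_hasTriangleAdjacentToCycle_five h5 hab hbc hca hbx hxy hyz hza hn

/-! ### From a plane drawing to the bound -/

theorem PlaneDrawing.exists_ends {V : Type*} {G : SimpleGraph V} (P : G.PlaneDrawing)
    (e : G.edgeSet) :
    ∃ u v, (e : Sym2 V) = s(u, v) ∧ P.arc e 0 = P.point u ∧ P.arc e 1 = P.point v := by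
  obtain ⟨e, he⟩ := e
  induction e using Sym2.ind with
  | _ a b =>
  have h := P.arc_ends ⟨s(a, b), he⟩
  rw [Sym2.map_mk, Sym2.eq_iff] at h
  rcases h with ⟨h0, h1⟩ | ⟨h0, h1⟩
  · exact ⟨a, b, rfl, h0, h1⟩
  · exact ⟨b, a, Sym2.eq_swap, h0, h1⟩

/-- The arcs of a plane drawing, in the complex plane. -/
theorem PlaneDrawing.exists_arcSystem {V : Type*} {G : SimpleGraph V} (P : G.PlaneDrawing) :
    ∃ D : ArcSystem V G.edgeSet, ∀ e : G.edgeSet, (e : Sym2 V) = s(D.src e, D.tgt e) := by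
  choose u v huv h0 h1 using P.exists_ends
  let L := Complex.orthonormalBasisOneI.repr.symm
  exact ⟨{ pt := L ∘ P.point
           arc := fun e => L ∘ P.arc e
           src := u
           tgt := v
           pt_injective := L.injective.comp P.point_injective
           arc_continuous := fun e => L.continuous.comp (P.arc_continuous e)
           arc_injective := fun e => L.injective.comp (P.arc_injective e)
           arc_zero := fun e => congrArg L (h0 e)
           arc_one := fun e => congrArg L (h1 e)
           arc_ne_pt := fun e t ht w h => P.arc_ne_point e t ht w (L.injective h)
           arc_ne_arc := fun e f hef s hs t ht h => P.arc_ne_arc e f hef s hs t ht (L.injective h) },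
    huv⟩

end SimpleGraph

theorem mainTheorem6 {V : Type*} [Fintype V] (G : SimpleGraph V) [Fintype G.edgeSet]
    (hplanar : G.IsPlanar)
    (h3 : ¬ G.HasTriangleAdjacentToCycle 3)
    (h5 : ¬ G.HasTriangleAdjacentToCycle 5)
    (hn : 4 ≤ Fintype.card V) :
    G.edgeFinset.card ≤ 2 * (Fintype.card V - 2) := by
  classical
  obtain ⟨P⟩ := hplanar
  obtain ⟨D, hD⟩ := P.exists_arcSystem
  have : Nonempty V := Fintype.card_pos_iff.1 (by omega)
  obtain ⟨ι, _, S, hne, heven, hpair, hdup, hcard⟩ := D.exists_faces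
  rw [SimpleGraph.edgeFinset_card]
  rcases hcard with hcard | hcard
  swap
  · omega
  by_cases hinj : Function.Injective S
  swap
  -- Two faces with the same boundary are the only faces, so |E| ≤ n, and n ≤ 2(n - 2) because n ≥
  -- 4.
  · obtain ⟨i, j, hS, hij⟩ : ∃ i j, S i = S j ∧ i ≠ j := by
      simpa [Function.Injective] using hinj
    have h1 : (Finset.univ : Finset ι) ⊆ {i, j} := fun k _ => by
      simpa using hdup i j hij hS k
    have h2 := (Finset.card_le_card h1).trans Finset.card_le_two
    rw [Finset.card_univ] at h2
    omega
  let T : ι → Finset (Sym2 V) := fun i => (S i).map (Function.Embedding.subtype _)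
  have hT : ∀ i, G.IsEvenEdgeSet (T i) := fun i => by
    refine ⟨fun e he => ?_, fun v => ?_⟩
    · obtain ⟨e', -, rfl⟩ := Finset.mem_map.1 he
      exact e'.2
    · have := heven i v
      rw [Finset.filter_map, Finset.card_map]
      convert this using 4 with e
      simp [hD e, eq_comm]
  have hTc : ∀ i, (T i).card = (S i).card := fun i => Finset.card_map _
  have hmem : ∀ i (e : G.edgeSet), e ∈ S i → (e : Sym2 V) ∈ T i := fun i e he =>
    Finset.mem_map.2 ⟨e, he, rfl⟩
  have h2 := two_mul_card_le_of_discharging S (fun i => ?_) hpair fun i j e hij hi hj hi3 => ?_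
  -- 2|F| ≤ |E| and |E| + 2 ≤ |F| + n give 2|E| + 4 ≤ |E| + 2n.
  · omega
  · obtain ⟨e, he⟩ := hne i
    rw [← hTc]
    have := hmem i e he
    rw [hD] at this
    exact (hT i).three_le_card this
  · rw [← hTc] at hi3 ⊢
    exact (hT i).six_le_card h3 h5 (hT j) (fun h => hij (hinj (Finset.map_injective _ h))) hi3
      (hmem i e hi) (hmem j e hj)
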